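/- Let $d\in\mathbb N$, $\beta>0$, and let $V:\mathbb R^d\to\mathbb R$ be $C^\infty$ and periodic with respect to a full-rank lattice of $\mathbb R^d$ (that is, $V$ is a smooth potential on a compact cell with periodic boundary conditions). Put $$\sigma=\frac{\beta}{3}\nabla^2V,\qquad F=\frac{\beta}{6}\bigl(\nabla(\Delta V)-\beta\,\nabla^2V\,\nabla V\bigr).$$ Call $\Delta t>0$ admissible if $\mathrm{Id}+\Delta t\,\sigma(q)$ is symmetric positive definite for all $q\in\mathbb R^d$ (in particular every $0<\Delta t<1/\|\sigma\|_{L^\infty}$ is admissible). For admissible $\Delta t$ and $q,q',G\in\mathbb R^d$ set $$\Phi^{\rm mod}_{\Delta t}(q,G)=q-\beta\Delta t\,\nabla V(q)+\Delta t^2F(q)+\sqrt{2\Delta t}\,\bigl(\mathrm{Id}+\Delta t\,\sigma(q)\bigr)^{-1/2}G,$$ $$T^{\rm mod}_{\Delta t}(q,q')=\Bigl(\frac1{4\pi\Delta t}\Bigr)^{d/2}\det\bigl(\mathrm{Id}+\Delta t\,\sigma(q)\bigr)^{1/2}\exp\Bigl(-\frac{v^T(\mathrm{Id}+\Delta t\,\sigma(q))v}{4\Delta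 t}\Bigr),\quad v=q'-q+\Delta t\bigl[\beta\nabla V(q)-\Delta t\,F(q)\bigr],$$ $$A^{\rm mod}_{\Delta t}(q,q')=\min\Bigl(\frac{e^{-\beta V(q')}\,T^{\rm mod}_{\Delta t}(q',q)}{e^{-\beta V(q)}\,T^{\rm mod}_{\Delta t}(q,q')},\,1\Bigr).$$ Then for every integer $\ell\ge1$ there is a constant $C_\ell>0$ (depending only on $\ell$, $d$, $\beta$ and $V$) such that, for every admissible $\Delta t$ and every $q\in\mathbb R^d$, $$\mathbb E_G\Bigl[\bigl(1-A^{\rm mod}_{\Delta t}(q,\Phi^{\rm mod}_{\Delta t}(q,G))\bigr)^{2\ell}\Bigr]\le C_\ell\,\Delta t^{5\ell},$$ where $G$ is a standard $d$-dimensional Gaussian random variable. -/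

import Mathlib

open MeasureTheory ProbabilityTheory
open scoped ContDiff Matrix

noncomputable section

namespace LangevinMH

/-- The Euclidean space in which configurations are unfolded. -/
abbrev Conf (d : ℕ) : Type := EuclideanSpace ℝ (Fin d)

variable {d : ℕ}

/-- The Hessian matrix `∇²V(q)`, with entries `∂ᵢ∂ⱼV(q)`. -/
def hessian (V : Conf d → ℝ) (q : Conf d) : Matrix (Fin d) (Fin d) ℝ :=
  Matrix.of fun i j =>
    iteratedFDeriv ℝ 2 V q ![EuclideanSpace.single i 1, EuclideanSpace.single j 1]

/-- The action of a square matrix on a vector of the Euclidean space. -/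
def act (M : Matrix (Fin d) (Fin d) ℝ) (v : Conf d) : Conf d :=
  WithLp.toLp 2 (M *ᵥ v.ofLp)

/-- The quadratic form `vᵀ M v`. -/
def quadForm (M : Matrix (Fin d) (Fin d) ℝ) (v : Conf d) : ℝ :=
  v.ofLp ⬝ᵥ (M *ᵥ v.ofLp)

/-- The inverse square root `M^{-1/2}` of a symmetric positive definite matrix, by spectral
calculus. -/
def invSqrt (M : Matrix (Fin d) (Fin d) ℝ) : Matrix (Fin d) (Fin d) ℝ :=
  cfc (fun x : ℝ => (Real.sqrt x)⁻¹) M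

/-- The matrix `Id + Δt σ(q)`. -/
def precision (σ : Conf d → Matrix (Fin d) (Fin d) ℝ) (Δt : ℝ) (q : Conf d) :
    Matrix (Fin d) (Fin d) ℝ :=
  1 + Δt • σ q

/-- The Euler-Maruyama proposal `q - β Δt ∇V(q) + √(2Δt) G`. -/
def proposalEM (β : ℝ) (V : Conf d → ℝ) (Δt : ℝ) (q G : Conf d) : Conf d :=
  q - (β * Δt) • gradient V q + Real.sqrt (2 * Δt) • G

/-- The modified proposal
`Φ^EM(q,G) + Δt² F(q) + √(2Δt) [(Id + Δt σ(q))^{-1/2} - Id] G`. -/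
def proposalMod (β : ℝ) (V : Conf d → ℝ) (σ : Conf d → Matrix (Fin d) (Fin d) ℝ)
    (F : Conf d → Conf d) (Δt : ℝ) (q G : Conf d) : Conf d :=
  proposalEM β V Δt q G + Δt ^ 2 • F q
    + Real.sqrt (2 * Δt) • act (invSqrt (precision σ Δt q) - 1) G

/-- The transition density `T^mod(q,q')` of the modified proposal. -/
def transitionMod (β : ℝ) (V : Conf d → ℝ) (σ : Conf d → Matrix (Fin d) (Fin d) ℝ)
    (F : Conf d → Conf d) (Δt : ℝ) (q q' : Conf d) : ℝ :=
  (1 / (4 * Real.pi * Δt)) ^ ((d : ℝ) / 2) * Real.sqrt (precision σ Δt q).det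
    * Real.exp (-(quadForm (precision σ Δt q)
        (q' - q + Δt • (β • gradient V q - Δt • F q)) / (4 * Δt)))

/-- The Metropolis-Hastings acceptance probability `A^mod(q,q')` of the modified proposal. -/
def acceptMod (β : ℝ) (V : Conf d → ℝ) (σ : Conf d → Matrix (Fin d) (Fin d) ℝ)
    (F : Conf d → Conf d) (Δt : ℝ) (q q' : Conf d) : ℝ :=
  min ((Real.exp (-β * V q') * transitionMod β V σ F Δt q' q)
    / (Real.exp (-β * V q) * transitionMod β V σ F Δt q q')) 1

/-- The choice `σ = (β/3) ∇²V`. -/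
def sigmaChoice (β : ℝ) (V : Conf d → ℝ) (q : Conf d) : Matrix (Fin d) (Fin d) ℝ :=
  (β / 3) • hessian V q

/-- The choice `F = (β/6) (∇(ΔV) - β ∇²V ∇V)`. -/
def driftChoice (β : ℝ) (V : Conf d → ℝ) (q : Conf d) : Conf d :=
  (β / 6) • (gradient (Laplacian.laplacian V) q - β • act (hessian V q) (gradient V q))

/-- The time steps for which the modified scheme is defined: `Δt > 0` and `Id + Δt σ(q)` is
symmetric positive definite at every configuration. This contains all `0 < Δt < 1/‖σ‖_{L^∞}`. -/
def Admissible (σ : Conf d → Matrix (Fin d) (Fin d) ℝ) (Δt : ℝ) : Prop :=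
  0 < Δt ∧ ∀ q, (precision σ Δt q).PosDef

/-- `V` is periodic with respect to the full-rank lattice generated by the basis `b`, so that it
is a function on the compact periodic cell `ℝ^d / (ℤ b₁ + ⋯ + ℤ b_d)`. -/
def IsPeriodic (b : Module.Basis (Fin d) ℝ (Conf d)) (V : Conf d → ℝ) : Prop :=
  ∀ (i : Fin d) (q : Conf d), V (q + b i) = V q

end LangevinMH

end

/-! Write `h` for the time step, `x = q' - q` and `D = ‖x‖`. The acceptance probability is `min (exp
R) 1` with `R` the logarithm of the Metropolis-Hastings ratio, and `1 - min (exp R) 1 ≤ |R|`, so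
everything rests on showing that `R` has size `h^(5/2)` along the proposal.

Expand `R` in powers of `h` with `x` kept free (`logRatio_eq`). The `‖x‖²/h` terms cancel. At order
`h⁰`, the choice of `σ` turns what remains into the trapezoidal rule for `V` on the segment from `q`
to `q'` with its first Euler-Maclaurin correction, whose error is `O(D⁵)`. At order `h`, the choice
of `F` makes `β σ ∇V - F` the gradient of `β²/4 ‖∇V‖² - β/6 ΔV` (`gradient_correctionPotential`).
The trace of `σ` from the log-determinant supplies the Laplacian part of this potential, so the
plain trapezoidal error `O(D³)` remains, times `h`. The rest of the log-determinant and all other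
terms are `O(h² D)`, by periodicity and smoothness.

Hence `|R| ≤ C (D⁵ + h D³ + h² D)` for small `h` (`exists_logRatio_le`). The proposal moves by `D =
O(√h (1 + ‖G‖))`, which gives `O(h^(5/2) (1 + ‖G‖)⁵)`; raising this to the power `2ℓ` and using
Gaussian moments gives the rate. For `h` bounded below, the trivial bound `1 - A ≤ 1` suffices. -/

namespace LangevinMH

/-! ### Smooth periodic functions: closure properties and uniform bounds. -/

section SmoothPeriodic

variable {d : ℕ} {E F : Type*} [NormedAddCommGroup E] [NormedSpace ℝ E]
  [NormedAddCommGroup F] [NormedSpace ℝ F] {b : Module.Basis (Fin d) ℝ (Conf d)}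

/-- Smooth functions on `ℝ^d` that are periodic with respect to the lattice generated by `b`. -/
structure SmoothPeriodic (b : Module.Basis (Fin d) ℝ (Conf d)) (f : Conf d → E) : Prop where
  smooth : ContDiff ℝ ∞ f
  periodic : ∀ i q, f (q + b i) = f q

namespace SmoothPeriodic

theorem const (c : E) : SmoothPeriodic b (fun _ : Conf d => c) :=
  ⟨contDiff_const, fun _ _ => rfl⟩

theorem comp {f : Conf d → E} (hf : SmoothPeriodic b f) {φ : E → F} (hφ : ContDiff ℝ ∞ φ) :
    SmoothPeriodic b (fun q => φ (f q)) :=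
  ⟨hφ.comp hf.smooth, fun i q => by rw [hf.periodic]⟩

theorem comp₂ {G : Type*} [NormedAddCommGroup G] [NormedSpace ℝ G]
    {f : Conf d → E} {g : Conf d → F} (hf : SmoothPeriodic b f) (hg : SmoothPeriodic b g)
    {φ : E × F → G} (hφ : ContDiff ℝ ∞ φ) : SmoothPeriodic b (fun q => φ (f q, g q)) :=
  ⟨hφ.comp (hf.smooth.prodMk hg.smooth), fun i q => by rw [hf.periodic, hg.periodic]⟩

theorem add {f g : Conf d → E} (hf : SmoothPeriodic b f) (hg : SmoothPeriodic b g) :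
    SmoothPeriodic b (fun q => f q + g q) :=
  hf.comp₂ hg (φ := fun p => p.1 + p.2) (by fun_prop)

theorem sub {f g : Conf d → E} (hf : SmoothPeriodic b f) (hg : SmoothPeriodic b g) :
    SmoothPeriodic b (fun q => f q - g q) :=
  hf.comp₂ hg (φ := fun p => p.1 - p.2) (by fun_prop)

theorem mul {f g : Conf d → ℝ} (hf : SmoothPeriodic b f) (hg : SmoothPeriodic b g) :
    SmoothPeriodic b (fun q => f q * g q) :=
  hf.comp₂ hg (φ := fun p => p.1 * p.2) (by fun_prop)

theorem neg {f : Conf d → E} (hf : SmoothPeriodic b f) : SmoothPeriodic b (fun q => -f q) :=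
  hf.comp (φ := fun p => -p) (by fun_prop)

theorem const_smul {f : Conf d → E} (hf : SmoothPeriodic b f) (c : ℝ) :
    SmoothPeriodic b (fun q => c • f q) :=
  hf.comp (φ := fun p => c • p) (by fun_prop)

theorem const_mul {f : Conf d → ℝ} (hf : SmoothPeriodic b f) (c : ℝ) :
    SmoothPeriodic b (fun q => c * f q) :=
  hf.const_smul c

theorem sum {ι : Type*} {s : Finset ι} {f : ι → Conf d → E}
    (hf : ∀ i ∈ s, SmoothPeriodic b (f i)) : SmoothPeriodic b (fun q => ∑ i ∈ s, f i q) :=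
  ⟨ContDiff.sum fun i hi => (hf i hi).smooth,
    fun j q => Finset.sum_congr rfl fun i hi => (hf i hi).periodic j q⟩

theorem inner {f g : Conf d → Conf d} (hf : SmoothPeriodic b f) (hg : SmoothPeriodic b g) :
    SmoothPeriodic b (fun q => inner ℝ (f q) (g q)) :=
  hf.comp₂ hg (φ := fun p => Inner.inner ℝ p.1 p.2) (contDiff_fst.inner ℝ contDiff_snd)

theorem clm_apply {L : Conf d → E →L[ℝ] F} {f : Conf d → E} (hL : SmoothPeriodic b L)
    (hf : SmoothPeriodic b f) : SmoothPeriodic b (fun q => L q (f q)) :=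
  hL.comp₂ hf (φ := fun p => p.1 p.2) (contDiff_fst.clm_apply contDiff_snd)

theorem fderiv {f : Conf d → E} (hf : SmoothPeriodic b f) :
    SmoothPeriodic b (fderiv ℝ f) := by
  refine ⟨(contDiff_infty_iff_fderiv.1 hf.smooth).2, fun i q => ?_⟩
  rw [← fderiv_comp_add_right]
  congr 1
  exact funext (hf.periodic i)

theorem iteratedFDeriv {f : Conf d → E} (hf : SmoothPeriodic b f) (n : ℕ) :
    SmoothPeriodic b (iteratedFDeriv ℝ n f) := by
  refine ⟨hf.smooth.iteratedFDeriv_right (by exact_mod_cast le_top), fun i q => ?_⟩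
  rw [← iteratedFDeriv_comp_add_right]
  congr 1
  exact funext (hf.periodic i)

theorem gradient {f : Conf d → ℝ} (hf : SmoothPeriodic b f) :
    SmoothPeriodic b (gradient f) :=
  hf.fderiv.comp (φ := (InnerProductSpace.toDual ℝ (Conf d)).symm)
    (InnerProductSpace.toDual ℝ (Conf d)).symm.toContinuousLinearEquiv.contDiff

theorem apply_zspan {f : Conf d → E} (hf : SmoothPeriodic b f) {v : Conf d}
    (hv : v ∈ Submodule.span ℤ (Set.range b)) (q : Conf d) : f (q + v) = f q := by
  induction hv using Submodule.span_induction generalizing q with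
  | mem x hx => obtain ⟨i, rfl⟩ := hx; exact hf.periodic i q
  | zero => simp
  | add x y _ _ hx hy => rw [← add_assoc, hy, hx]
  | smul a x _ hx =>
    induction a using Int.induction_on generalizing q with
    | zero => simp
    | succ n ih => rw [add_smul, one_smul, ← add_assoc, hx, ih]
    | pred n ih => rw [← hx (q + _), add_assoc, sub_smul, one_smul, sub_add_cancel, ih]

/-- Every point is a lattice translate of its fractional part, which lies in the ball of radius `∑
i, ‖b i‖`; compactness of that ball replaces compactness of the torus. -/
theorem bounded {f : Conf d → E} (hf : SmoothPeriodic b f) : ∃ K, 0 ≤ K ∧ ∀ q, ‖f q‖ ≤ K := by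
  obtain ⟨K, hK⟩ := (isCompact_closedBall (0 : Conf d) (∑ i, ‖b i‖)).exists_bound_of_continuousOn
    hf.smooth.continuous.continuousOn
  refine ⟨max K 0, le_max_right _ _, fun q => le_max_of_le_left ?_⟩
  have h : f (ZSpan.fract b q) = f q := by
    rw [← hf.apply_zspan (ZSpan.floor b q).2, ZSpan.fract_apply, sub_add_cancel]
  rw [← h]
  exact hK _ (by simpa using ZSpan.norm_fract_le b q)

theorem lipschitz {f : Conf d → E} (hf : SmoothPeriodic b f) :
    ∃ K, 0 ≤ K ∧ ∀ q q', ‖f q' - f q‖ ≤ K * ‖q' - q‖ := by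
  obtain ⟨K, hK0, hK⟩ := hf.fderiv.bounded
  exact ⟨K, hK0, fun q q' => convex_univ.norm_image_sub_le_of_norm_fderiv_le
    (fun x _ => (hf.smooth.differentiable (by simp)).differentiableAt) (fun x _ => hK x)
    (Set.mem_univ _) (Set.mem_univ _)⟩

theorem exists_bound_lipschitz {f : Conf d → E} (hf : SmoothPeriodic b f) :
    ∃ K, 0 ≤ K ∧ (∀ q, ‖f q‖ ≤ K) ∧ ∀ q q', ‖f q' - f q‖ ≤ K * ‖q' - q‖ := by
  obtain ⟨K, hK0, hK⟩ := hf.bounded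
  obtain ⟨L, hL0, hL⟩ := hf.lipschitz
  exact ⟨max K L, le_max_of_le_left hK0, fun q => (hK q).trans (le_max_left _ _),
    fun q q' => (hL q q').trans (by gcongr; exact le_max_right _ _)⟩

end SmoothPeriodic

end SmoothPeriodic

/-! ### Errors of the trapezoidal rules along segments. -/

section Taylor

/-- Iterating this integrates a bound on a higher derivative of a quadrature error, provided the
error and its intermediate derivatives vanish at `0`. Keeping the same `K` at each stage is not
sharp, but only the power of the step length matters. -/
theorem abs_le_of_abs_deriv_le {e e' : ℝ → ℝ} {K : ℝ} (he : ∀ t, HasDerivAt e (e' t) t)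
    (h0 : e 0 = 0) (hK : ∀ t ∈ Set.Icc (0 : ℝ) 1, |e' t| ≤ K) :
    ∀ t ∈ Set.Icc (0 : ℝ) 1, |e t| ≤ K := by
  intro t ht
  have h := (convex_Icc (0 : ℝ) 1).norm_image_sub_le_of_norm_hasDerivWithin_le
    (fun x _ => (he x).hasDerivWithinAt) hK (Set.left_mem_Icc.2 zero_le_one) ht
  have hK0 : 0 ≤ K := (abs_nonneg _).trans (hK t ht)
  rw [h0, sub_zero, sub_zero, Real.norm_eq_abs, Real.norm_eq_abs, abs_of_nonneg ht.1] at h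
  exact h.trans (mul_le_of_le_one_right hK0 ht.2)

/-- The error of the trapezoidal rule. -/
theorem abs_trapezoid_le {f : ℕ → ℝ → ℝ} (hf : ∀ n t, HasDerivAt (f n) (f (n + 1) t) t) {K : ℝ}
    (hK : ∀ t ∈ Set.Icc (0 : ℝ) 1, |f 3 t| ≤ K) :
    |f 0 1 - f 0 0 - (f 1 1 + f 1 0) / 2| ≤ K := by
  have h1 : ∀ t ∈ Set.Icc (0 : ℝ) 1, |-(t / 2 * f 3 t)| ≤ K := by
    intro t ht
    rw [abs_neg, abs_mul, abs_of_nonneg (by linarith [ht.1])]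
    have := hK t ht
    have h2 := abs_nonneg (f 3 t)
    nlinarith [ht.1, ht.2]
  have h2 : ∀ t ∈ Set.Icc (0 : ℝ) 1, |(f 1 t - f 1 0) / 2 - t / 2 * f 2 t| ≤ K := by
    refine abs_le_of_abs_deriv_le (fun t => ?_) (by simp) h1
    have := ((((hf 1 t).sub_const (f 1 0)).div_const 2)).sub
      (((hasDerivAt_id t).div_const 2).mul (hf 2 t))
    refine this.congr_deriv ?_
    simp only [id]; ring
  have h3 := abs_le_of_abs_deriv_le (e := fun t => f 0 t - f 0 0 - t / 2 * (f 1 t + f 1 0))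
    (fun t => ?_) (by simp) h2 1 (by simp)
  · rw [show f 0 1 - f 0 0 - (f 1 1 + f 1 0) / 2 = f 0 1 - f 0 0 - 1 / 2 * (f 1 1 + f 1 0) by ring]
    exact h3
  · have := (((hf 0 t).sub_const (f 0 0))).sub
      (((hasDerivAt_id t).div_const 2).mul ((hf 1 t).add_const (f 1 0)))
    refine this.congr_deriv ?_
    simp only [id]; ring

/-- The error of the trapezoidal rule with the first Euler-Maclaurin correction. -/
theorem abs_corrected_trapezoid_le {f : ℕ → ℝ → ℝ} (hf : ∀ n t, HasDerivAt (f n) (f (n + 1) t) t)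
    {K : ℝ} (hK : ∀ t ∈ Set.Icc (0 : ℝ) 1, |f 5 t| ≤ K) :
    |f 0 1 - f 0 0 - (f 1 1 + f 1 0) / 2 + (f 2 1 - f 2 0) / 12| ≤ K := by
  -- Regard the error as a function of the right endpoint `t`. Its third derivative is `t² / 12 * f
  -- 5 t`: the weights `1/2` and `1/12` are those for which the lower-order terms cancel. `h2` and
  -- `h3` bound the second and first derivatives.
  have h1 : ∀ t ∈ Set.Icc (0 : ℝ) 1, |t ^ 2 / 12 * f 5 t| ≤ K := by
    intro t ht
    rw [abs_mul, abs_of_nonneg (by positivity)]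
    have := hK t ht
    have h2 := abs_nonneg (f 5 t)
    have : t ^ 2 / 12 ≤ 1 := by nlinarith [ht.1, ht.2]
    nlinarith
  have hsq (t : ℝ) : HasDerivAt (fun t : ℝ => t ^ 2 / 12) (t / 6) t := by
    refine ((hasDerivAt_pow 2 t).div_const 12).congr_deriv ?_
    ring
  have h2 : ∀ t ∈ Set.Icc (0 : ℝ) 1, |(f 2 t - f 2 0) / 6 - t / 6 * f 3 t
      + t ^ 2 / 12 * f 4 t| ≤ K := by
    refine abs_le_of_abs_deriv_le (fun t => ?_) (by simp) h1
    have := (((((hf 2 t).sub_const (f 2 0)).div_const 6)).sub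
      (((hasDerivAt_id t).div_const 6).mul (hf 3 t))).add ((hsq t).mul (hf 4 t))
    refine this.congr_deriv ?_
    simp only [id]; ring
  have h3 : ∀ t ∈ Set.Icc (0 : ℝ) 1, |(f 1 t - f 1 0) / 2 - t / 2 * f 2 t
      + t / 6 * (f 2 t - f 2 0) + t ^ 2 / 12 * f 3 t| ≤ K := by
    refine abs_le_of_abs_deriv_le (fun t => ?_) (by simp) h2
    have := ((((((hf 1 t).sub_const (f 1 0)).div_const 2)).sub
      (((hasDerivAt_id t).div_const 2).mul (hf 2 t))).add
      (((hasDerivAt_id t).div_const 6).mul ((hf 2 t).sub_const (f 2 0)))).add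
      ((hsq t).mul (hf 3 t))
    refine this.congr_deriv ?_
    simp only [id]; ring
  have h4 := abs_le_of_abs_deriv_le (e := fun t => f 0 t - f 0 0 - t / 2 * (f 1 t + f 1 0)
      + t ^ 2 / 12 * (f 2 t - f 2 0))
    (fun t => ?_) (by simp) h3 1 (by simp)
  · rw [show f 0 1 - f 0 0 - (f 1 1 + f 1 0) / 2 + (f 2 1 - f 2 0) / 12
      = f 0 1 - f 0 0 - 1 / 2 * (f 1 1 + f 1 0) + 1 ^ 2 / 12 * (f 2 1 - f 2 0) by ring]
    exact h4
  · have := ((((hf 0 t).sub_const (f 0 0))).sub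
      (((hasDerivAt_id t).div_const 2).mul ((hf 1 t).add_const (f 1 0)))).add
      ((hsq t).mul ((hf 2 t).sub_const (f 2 0)))
    refine this.congr_deriv ?_
    simp only [id]; ring

variable {d : ℕ} {b : Module.Basis (Fin d) ℝ (Conf d)}

theorem hasDerivAt_iteratedFDeriv_line {f : Conf d → ℝ} (hf : ContDiff ℝ ∞ f) (q v : Conf d)
    (n : ℕ) (t : ℝ) :
    HasDerivAt (fun t : ℝ => iteratedFDeriv ℝ n f (q + t • v) fun _ => v)
      (iteratedFDeriv ℝ (n + 1) f (q + t • v) fun _ => v) t := by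
  have h1 : HasFDerivAt (iteratedFDeriv ℝ n f) (fderiv ℝ (iteratedFDeriv ℝ n f) (q + t • v))
      (q + t • v) :=
    (hf.differentiable_iteratedFDeriv (by exact_mod_cast WithTop.coe_lt_top _) _).hasFDerivAt
  have h2 : HasDerivAt (fun t : ℝ => q + t • v) v t := by
    simpa using ((hasDerivAt_id t).smul_const v).const_add q
  have h3 := h1.comp_hasDerivAt t h2
  have h4 := (ContinuousMultilinearMap.apply ℝ (fun _ : Fin n => Conf d) ℝ
    (fun _ => v)).hasFDerivAt.comp_hasDerivAt t h3
  refine h4.congr_deriv ?_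
  rw [iteratedFDeriv_succ_apply_left]
  rfl

theorem exists_abs_line_le {f : Conf d → ℝ} (hf : SmoothPeriodic b f) (n : ℕ) :
    ∃ K, 0 ≤ K ∧ ∀ q v : Conf d, |iteratedFDeriv ℝ n f q fun _ => v| ≤ K * ‖v‖ ^ n := by
  obtain ⟨K, hK0, hK⟩ := (hf.iteratedFDeriv n).bounded
  refine ⟨K, hK0, fun q v => ?_⟩
  refine ((iteratedFDeriv ℝ n f q).le_opNorm _).trans ?_
  simp only [Finset.prod_const, Finset.card_univ, Fintype.card_fin]
  gcongr
  exact hK q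

theorem exists_trapezoid_le {f : Conf d → ℝ} (hf : SmoothPeriodic b f) :
    ∃ K, 0 ≤ K ∧ ∀ q q' : Conf d,
      |f q' - f q - inner ℝ (q' - q) (gradient f q' + gradient f q) / 2| ≤ K * ‖q' - q‖ ^ 3 := by
  obtain ⟨K, hK0, hK⟩ := exists_abs_line_le hf 3
  refine ⟨K, hK0, fun q q' => ?_⟩
  have := abs_trapezoid_le (hasDerivAt_iteratedFDeriv_line hf.smooth q (q' - q))
    (fun t _ => hK (q + t • (q' - q)) (q' - q))
  simp only [iteratedFDeriv_zero_apply, iteratedFDeriv_one_apply, one_smul, zero_smul,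
    add_sub_cancel, add_zero] at this
  simpa only [inner_add_left, real_inner_comm _ (q' - q), inner_gradient_left] using this

end Taylor

end LangevinMH

namespace LangevinMH

/-! ### Matrix action and the inverse square root. -/

section Act

variable {d : ℕ}

theorem act_one (v : Conf d) : act 1 v = v := by simp [act]

theorem act_add_left (M N : Matrix (Fin d) (Fin d) ℝ) (v : Conf d) :
    act (M + N) v = act M v + act N v := by simp [act, Matrix.add_mulVec]

theorem act_sub_left (M N : Matrix (Fin d) (Fin d) ℝ) (v : Conf d) :
    act (M - N) v = act M v - act N v := by simp [act, Matrix.sub_mulVec]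

theorem act_smul_left (c : ℝ) (M : Matrix (Fin d) (Fin d) ℝ) (v : Conf d) :
    act (c • M) v = c • act M v := by simp [act, Matrix.smul_mulVec]

theorem act_mul (M N : Matrix (Fin d) (Fin d) ℝ) (v : Conf d) :
    act (M * N) v = act M (act N v) := by simp [act]

theorem quadForm_eq_inner (M : Matrix (Fin d) (Fin d) ℝ) (v : Conf d) :
    quadForm M v = inner ℝ v (act M v) := by
  simp [quadForm, act, EuclideanSpace.inner_eq_star_dotProduct, dotProduct_comm]

theorem inner_act_of_isHermitian {M : Matrix (Fin d) (Fin d) ℝ} (hM : M.IsHermitian)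
    (v w : Conf d) : inner ℝ v (act M w) = inner ℝ (act M v) w := by
  have h : Mᵀ = M := by rwa [Matrix.IsHermitian, Matrix.conjTranspose_eq_transpose_of_trivial] at hM
  simp only [act, EuclideanSpace.inner_eq_star_dotProduct, star_trivial]
  rw [dotProduct_comm, Matrix.dotProduct_mulVec, ← Matrix.mulVec_transpose, h, dotProduct_comm]

theorem continuous_act (M : Matrix (Fin d) (Fin d) ℝ) : Continuous (act M) := by
  unfold act
  fun_prop

theorem isHermitian_invSqrt (M : Matrix (Fin d) (Fin d) ℝ) : (invSqrt M).IsHermitian :=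
  cfc_predicate (fun x : ℝ => (Real.sqrt x)⁻¹) M

theorem invSqrt_mul_mul_invSqrt {M : Matrix (Fin d) (Fin d) ℝ} (hM : M.PosDef) :
    invSqrt M * M * invSqrt M = 1 := by
  have hsa : IsSelfAdjoint M := hM.1
  have hpos : ∀ x ∈ spectrum ℝ M, 0 < x := by
    intro x hx
    rw [hM.1.spectrum_real_eq_range_eigenvalues] at hx
    obtain ⟨i, rfl⟩ := hx
    exact hM.eigenvalues_pos i
  have hcont : ContinuousOn (fun x : ℝ => (Real.sqrt x)⁻¹) (spectrum ℝ M) :=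
    Real.continuous_sqrt.continuousOn.inv₀ fun x hx => (Real.sqrt_pos.2 (hpos x hx)).ne'
  have hid : M = cfc (fun x : ℝ => x) M := (cfc_id' ℝ M).symm
  have h1 : invSqrt M * M = cfc (fun x : ℝ => (Real.sqrt x)⁻¹ * x) M := by
    conv_lhs => rw [invSqrt]; arg 2; rw [hid]
    rw [← cfc_mul _ (fun x : ℝ => x) M hcont continuousOn_id]
  rw [h1, invSqrt, ← cfc_mul (fun x : ℝ => (Real.sqrt x)⁻¹ * x) _ M (hcont.mul continuousOn_id) hcont]
  rw [cfc_congr (g := fun _ => (1 : ℝ)) (fun x hx => ?_), cfc_const_one ℝ M]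
  have h2 := hpos x hx
  have h3 := Real.sqrt_pos.2 h2
  have h4 := Real.mul_self_sqrt h2.le
  field_simp
  nlinarith

/-- With `w = M^{-1/2} v` one has `⟨w, M w⟩ = ‖v‖²`, so coercivity of `M` at `w` bounds `‖w‖`
without any spectral estimate. -/
theorem norm_act_invSqrt_le {M : Matrix (Fin d) (Fin d) ℝ} (hM : M.PosDef)
    (hlow : ∀ v : Conf d, ‖v‖ ^ 2 / 4 ≤ inner ℝ v (act M v)) (v : Conf d) :
    ‖act (invSqrt M) v‖ ≤ 2 * ‖v‖ := by
  have h : inner ℝ (act (invSqrt M) v) (act M (act (invSqrt M) v)) = ‖v‖ ^ 2 := by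
    rw [← inner_act_of_isHermitian (isHermitian_invSqrt M), ← act_mul, ← act_mul,
      invSqrt_mul_mul_invSqrt hM, act_one, real_inner_self_eq_norm_sq]
  have h1 := hlow (act (invSqrt M) v)
  rw [h] at h1
  exact abs_le_of_sq_le_sq' (by nlinarith) (by positivity) |>.2

end Act

/-! ### The Hessian as derivative of the gradient, and its trace. -/

section Hessian

variable {d : ℕ} {V : Conf d → ℝ}

theorem hessian_apply (V : Conf d → ℝ) (q : Conf d) (i j : Fin d) :
    hessian V q i j = fderiv ℝ (fderiv ℝ V) q (EuclideanSpace.single i 1)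
      (EuclideanSpace.single j 1) := by
  simp [hessian, iteratedFDeriv_two_apply]

theorem fderiv_fderiv_comm (hV : ContDiff ℝ ∞ V) (q v w : Conf d) :
    fderiv ℝ (fderiv ℝ V) q v w = fderiv ℝ (fderiv ℝ V) q w v :=
  (hV.contDiffAt.isSymmSndFDerivAt (by simpa using WithTop.coe_le_coe.2 (le_top (a := (2 : ℕ∞))))) v w

theorem isHermitian_hessian (hV : ContDiff ℝ ∞ V) (q : Conf d) : (hessian V q).IsHermitian := by
  ext i j
  simp [hessian_apply, fderiv_fderiv_comm hV]

/-- Differentiate the function `⟨v, ∇V⟩ = DV(v)` in its two forms and use uniqueness of the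
derivative. -/
theorem inner_fderiv_gradient (hV : ContDiff ℝ ∞ V) (q v w : Conf d) :
    inner ℝ v (fderiv ℝ (gradient V) q w) = fderiv ℝ (fderiv ℝ V) q w v := by
  have h1 : HasFDerivAt (fderiv ℝ V) (fderiv ℝ (fderiv ℝ V) q) q :=
    ((contDiff_infty_iff_fderiv.1 hV).2.differentiable (by simp) q).hasFDerivAt
  have h2 : HasFDerivAt (gradient V) (fderiv ℝ (gradient V) q) q :=
    (((InnerProductSpace.toDual ℝ (Conf d)).symm.toContinuousLinearEquiv.contDiff.comp
      (contDiff_infty_iff_fderiv.1 hV).2).differentiable (by simp) q).hasFDerivAt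
  have h3 := h1.clm_apply (hasFDerivAt_const v q)
  have h4 := (hasFDerivAt_const v q).inner ℝ h2
  have h5 : (fun x => inner ℝ v (gradient V x)) = fun x => fderiv ℝ V x v :=
    funext fun x => by rw [real_inner_comm, inner_gradient_left]
  rw [h5] at h4
  simpa using congrArg (fun L => L w) (h4.unique h3)

/-- This passes from matrix entries to a coordinate-free derivative, from which periodicity,
smoothness and operator bounds are inherited. -/
theorem act_hessian (hV : ContDiff ℝ ∞ V) (q w : Conf d) :
    act (hessian V q) w = fderiv ℝ (gradient V) q w := by
  ext i
  have h1 : (fderiv ℝ (gradient V) q w) i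
      = inner ℝ (EuclideanSpace.single i 1) (fderiv ℝ (gradient V) q w) := by
    simp [EuclideanSpace.inner_single_left]
  have h2 : w = ∑ j, w j • EuclideanSpace.single j (1 : ℝ) := by
    ext k; simp [Pi.single_apply]
  rw [h1, inner_fderiv_gradient hV]
  conv_rhs => rw [h2]
  simp only [act, Matrix.mulVec, dotProduct, hessian_apply, map_sum, map_smul,
    sum_apply, smul_apply, smul_eq_mul]
  exact Finset.sum_congr rfl fun j _ => by rw [fderiv_fderiv_comm hV, mul_comm]

theorem inner_act_hessian_self (hV : ContDiff ℝ ∞ V) (q v : Conf d) :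
    inner ℝ v (act (hessian V q) v) = iteratedFDeriv ℝ 2 V q fun _ => v := by
  rw [act_hessian hV, inner_fderiv_gradient hV, iteratedFDeriv_two_apply]

theorem trace_hessian (V : Conf d → ℝ) (q : Conf d) :
    (hessian V q).trace = Laplacian.laplacian V q := by
  rw [congrFun (InnerProductSpace.laplacian_eq_iteratedFDeriv_orthonormalBasis V
    (EuclideanSpace.basisFun (Fin d) ℝ)) q]
  simp [Matrix.trace, hessian]

variable {b : Module.Basis (Fin d) ℝ (Conf d)}

theorem SmoothPeriodic.hessian (hV : SmoothPeriodic b V) (i j : Fin d) :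
    SmoothPeriodic b fun q => hessian V q i j := by
  simp only [hessian_apply]
  exact (hV.fderiv.fderiv.clm_apply (.const _)).clm_apply (.const _)

theorem SmoothPeriodic.laplacian (hV : SmoothPeriodic b V) :
    SmoothPeriodic b (Laplacian.laplacian V) := by
  have h : Laplacian.laplacian V = fun q => ∑ i, LangevinMH.hessian V q i i :=
    funext fun q => (trace_hessian V q).symm
  rw [h]
  exact .sum fun i _ => hV.hessian i i

theorem SmoothPeriodic.act_hessian (hV : SmoothPeriodic b V) {w : Conf d → Conf d}
    (hw : SmoothPeriodic b w) : SmoothPeriodic b fun q => act (LangevinMH.hessian V q) (w q) := by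
  simp only [LangevinMH.act_hessian hV.smooth]
  exact hV.gradient.fderiv.clm_apply hw

theorem SmoothPeriodic.driftChoice (hV : SmoothPeriodic b V) (β : ℝ) :
    SmoothPeriodic b (driftChoice β V) :=
  (hV.laplacian.gradient.sub ((hV.act_hessian hV.gradient).const_smul β)).const_smul (β / 6)

theorem exists_corrected_trapezoid_le (hV : SmoothPeriodic b V) :
    ∃ K, 0 ≤ K ∧ ∀ q q' : Conf d,
      |V q' - V q - inner ℝ (q' - q) (gradient V q' + gradient V q) / 2
        + (inner ℝ (q' - q) (act (hessian V q') (q' - q))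
          - inner ℝ (q' - q) (act (hessian V q) (q' - q))) / 12| ≤ K * ‖q' - q‖ ^ 5 := by
  obtain ⟨K, hK0, hK⟩ := exists_abs_line_le hV 5
  refine ⟨K, hK0, fun q q' => ?_⟩
  have := abs_corrected_trapezoid_le (hasDerivAt_iteratedFDeriv_line hV.smooth q (q' - q))
    (fun t _ => hK (q + t • (q' - q)) (q' - q))
  simp only [iteratedFDeriv_zero_apply, iteratedFDeriv_one_apply, one_smul, zero_smul,
    add_sub_cancel, add_zero] at this
  rw [real_inner_comm _ (q' - q)]
  simpa only [inner_add_left, inner_gradient_left, inner_act_hessian_self hV.smooth] using this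

end Hessian

/-! ### Expansion of the log-determinant. -/

section Determinant

variable {d : ℕ} {b : Module.Basis (Fin d) ℝ (Conf d)}

/-- The ring of smooth periodic functions. -/
def smoothPeriodicSubring (b : Module.Basis (Fin d) ℝ (Conf d)) : Subring (Conf d → ℝ) where
  carrier := {f | SmoothPeriodic b f}
  mul_mem' hf hg := SmoothPeriodic.mul hf hg
  one_mem' := SmoothPeriodic.const 1
  add_mem' hf hg := SmoothPeriodic.add hf hg
  zero_mem' := SmoothPeriodic.const 0
  neg_mem' hf := SmoothPeriodic.neg hf

/-- The determinant is expanded once, over the ring of smooth periodic functions, so that the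
coefficients belong to that ring automatically; evaluation at `q` is a ring homomorphism and
recovers the pointwise identity. -/
theorem exists_det_one_add_smul_eq {σ : Conf d → Matrix (Fin d) (Fin d) ℝ}
    (hσ : ∀ i j, SmoothPeriodic b fun q => σ q i j) :
    ∃ (n : ℕ) (c : ℕ → Conf d → ℝ), (∀ k, SmoothPeriodic b (c k)) ∧ ∀ (h : ℝ) (q : Conf d),
      (1 + h • σ q).det = 1 + h * (σ q).trace + h ^ 2 * ∑ k ∈ Finset.range n, c k q * h ^ k := by
  let S := smoothPeriodicSubring b
  let A : Matrix (Fin d) (Fin d) S := Matrix.of fun i j => ⟨fun q => σ q i j, hσ i j⟩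
  let p : Polynomial S :=
    (1 + (Polynomial.X : Polynomial S) • A.map Polynomial.C).det.divX.divX
  refine ⟨p.natDegree + 1, fun k => (p.coeff k : Conf d → ℝ), fun k => (p.coeff k).2,
    fun h q => ?_⟩
  let r : S := ⟨fun _ => h, SmoothPeriodic.const h⟩
  let ev : S →+* ℝ := (Pi.evalRingHom (fun _ : Conf d => ℝ) q).comp S.subtype
  have key := congrArg ev (Matrix.det_one_add_smul r A)
  have hA : ev.mapMatrix A = σ q := by ext i j; rfl
  have hM : ev.mapMatrix (1 + r • A) = 1 + h • σ q := by
    rw [map_add, map_one, ← hA]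
    congr 1
  rw [RingHom.map_det, hM] at key
  rw [key]
  have htr : ev A.trace = (σ q).trace := by
    rw [← hA]
    simp [Matrix.trace, RingHom.mapMatrix_apply]
  have hr : ev r = h := rfl
  have hp : ev (p.eval r) = ∑ k ∈ Finset.range (p.natDegree + 1),
      (p.coeff k : Conf d → ℝ) q * h ^ k := by
    rw [Polynomial.eval_eq_sum_range, map_sum]
    refine Finset.sum_congr rfl fun k _ => ?_
    rw [map_mul, map_pow, hr]
    rfl
  rw [← hp, map_add, map_add, map_one, map_mul, map_mul, map_pow, htr, hr]
  ring

/-- The derivative of `log (1 + t) - t` is `-t / (1 + t)`, at most `2 m` in absolute value on `[-m,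
m]`. -/
theorem abs_log_one_add_sub_self_le {x y m : ℝ} (hm : m ≤ 1 / 2) (hx : |x| ≤ m) (hy : |y| ≤ m) :
    |(Real.log (1 + y) - y) - (Real.log (1 + x) - x)| ≤ 2 * m * |y - x| := by
  have hm0 : 0 ≤ m := (abs_nonneg _).trans hx
  have := (convex_Icc (-m) m).norm_image_sub_le_of_norm_hasDerivWithin_le
    (f := fun t => Real.log (1 + t) - t) (f' := fun t => 1 / (1 + t) - 1) (C := 2 * m)
    (fun t ht => ?_) (fun t ht => ?_) (abs_le.1 hx) (abs_le.1 hy)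
  · simpa using this
  · have h1 : 1 + t ≠ 0 := by linarith [ht.1]
    exact ((((hasDerivAt_id t).const_add 1).log h1).sub (hasDerivAt_id t)).hasDerivWithinAt
  · have h1 : 0 < 1 + t := by linarith [ht.1]
    have h2 : 1 / (1 + t) - 1 = -t / (1 + t) := by field_simp; ring
    rw [h2, Real.norm_eq_abs, abs_div, abs_neg, abs_of_pos h1, div_le_iff₀ h1]
    have := abs_le.2 ht
    nlinarith [ht.1]

theorem exists_bound_lipschitz_polynomial {n : ℕ} {c : ℕ → Conf d → ℝ}
    (hc : ∀ k, SmoothPeriodic b (c k)) :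
    ∃ K, 0 ≤ K ∧ ∀ h : ℝ, 0 ≤ h → h ≤ 1 →
      (∀ q, |∑ k ∈ Finset.range n, c k q * h ^ k| ≤ K) ∧
      ∀ q q', |∑ k ∈ Finset.range n, c k q' * h ^ k - ∑ k ∈ Finset.range n, c k q * h ^ k|
        ≤ K * ‖q' - q‖ := by
  choose K hK0 hK hL using fun k => (hc k).exists_bound_lipschitz
  refine ⟨∑ k ∈ Finset.range n, K k, Finset.sum_nonneg fun k _ => hK0 k, fun h h0 h1 => ⟨fun q => ?_,
    fun q q' => ?_⟩⟩
  · refine (Finset.abs_sum_le_sum_abs _ _).trans (Finset.sum_le_sum fun k _ => ?_)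
    rw [abs_mul, abs_of_nonneg (pow_nonneg h0 k)]
    exact (mul_le_of_le_one_right (abs_nonneg _) (pow_le_one₀ h0 h1)).trans (hK k q)
  · rw [← Finset.sum_sub_distrib, Finset.sum_mul]
    refine (Finset.abs_sum_le_sum_abs _ _).trans (Finset.sum_le_sum fun k _ => ?_)
    rw [← sub_mul, abs_mul, abs_of_nonneg (pow_nonneg h0 k)]
    exact (mul_le_of_le_one_right (abs_nonneg _) (pow_le_one₀ h0 h1)).trans (hL k q q')

/-- Both gains are needed: `h²` from removing the trace, and `‖q' - q‖` from comparing two points. A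
bound `O(h²)` alone would lose the last half power of `h`. -/
theorem exists_log_det_le {σ : Conf d → Matrix (Fin d) (Fin d) ℝ}
    (hσ : ∀ i j, SmoothPeriodic b fun q => σ q i j) :
    ∃ K h₀, 0 ≤ K ∧ 0 < h₀ ∧ ∀ h : ℝ, 0 < h → h ≤ h₀ → ∀ q q',
      |Real.log (1 + h • σ q').det - Real.log (1 + h • σ q).det
        - h * ((σ q').trace - (σ q).trace)| ≤ K * h ^ 2 * ‖q' - q‖ := by
  obtain ⟨n, c, hc, hdet⟩ := exists_det_one_add_smul_eq hσ
  obtain ⟨K, hK0, hK⟩ := exists_bound_lipschitz_polynomial (n := n) hc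
  have htr : SmoothPeriodic b fun q => (σ q).trace := .sum fun i _ => hσ i i
  obtain ⟨T, hT0, hTb, hTL⟩ := htr.exists_bound_lipschitz
  simp only [Real.norm_eq_abs] at hTb hTL
  -- The threshold forces `h * (T + K) ≤ 1/2`, keeping the determinants in the range of the
  -- logarithm estimate.
  refine ⟨2 * (T + K) * (T + K) + K, min 1 (1 / (2 * (T + K + 1))), by positivity, by positivity,
    fun h h0 hh q q' => ?_⟩
  have h1 : h ≤ 1 := hh.trans (min_le_left _ _)
  have h2 : h * (T + K) ≤ 1 / 2 := by
    have := hh.trans (min_le_right _ _)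
    rw [le_div_iff₀ (by positivity)] at this
    nlinarith
  obtain ⟨hKb, hKL⟩ := hK h h0.le h1
  set r : Conf d → ℝ := fun q => ∑ k ∈ Finset.range n, c k q * h ^ k with hr
  set s : Conf d → ℝ := fun q => (σ q).trace + h * r q with hs
  have hds (q : Conf d) : (1 + h • σ q).det = 1 + h * s q := by rw [hdet, hs]; ring
  have hsb (q : Conf d) : |h * s q| ≤ h * (T + K) := by
    rw [abs_mul, abs_of_pos h0]
    gcongr
    refine (abs_add_le _ _).trans (add_le_add (hTb q) ?_)
    rw [abs_mul, abs_of_pos h0]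
    exact (mul_le_of_le_one_left (abs_nonneg _) h1).trans (hKb q)
  have hrL : |r q' - r q| ≤ K * ‖q' - q‖ := hKL q q'
  have hsL : |s q' - s q| ≤ (T + K) * ‖q' - q‖ := by
    have : s q' - s q = ((σ q').trace - (σ q).trace) + h * (r q' - r q) := by simp only [hs]; ring
    rw [this, add_mul]
    refine (abs_add_le _ _).trans (add_le_add (hTL q q') ?_)
    rw [abs_mul, abs_of_pos h0]
    exact (mul_le_of_le_one_left (abs_nonneg _) h1).trans hrL
  have hlog := abs_log_one_add_sub_self_le h2 (hsb q) (hsb q')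
  rw [hds, hds]
  have hsplit : Real.log (1 + h * s q') - Real.log (1 + h * s q)
      - h * ((σ q').trace - (σ q).trace)
      = ((Real.log (1 + h * s q') - h * s q') - (Real.log (1 + h * s q) - h * s q))
        + h ^ 2 * (r q' - r q) := by simp only [hs]; ring
  rw [hsplit]
  refine (abs_add_le _ _).trans ?_
  rw [abs_mul (h ^ 2), abs_of_nonneg (sq_nonneg h)]
  rw [← mul_sub, abs_mul h, abs_of_pos h0] at hlog
  calc _ ≤ 2 * (h * (T + K)) * (h * ((T + K) * ‖q' - q‖)) + h ^ 2 * (K * ‖q' - q‖) := by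
        gcongr
        exact hlog.trans (by gcongr)
    _ = _ := by ring

end Determinant

end LangevinMH

/-! ### Expansion of the logarithm of the acceptance ratio. -/

namespace LangevinMH

variable {d : ℕ} {b : Module.Basis (Fin d) ℝ (Conf d)} {V : Conf d → ℝ}

theorem isHermitian_sigmaChoice (hV : ContDiff ℝ ∞ V) (β : ℝ) (q : Conf d) :
    (sigmaChoice β V q).IsHermitian := by
  have h := isHermitian_hessian hV q
  rw [Matrix.IsHermitian] at h ⊢
  rw [sigmaChoice, Matrix.conjTranspose_smul, h, star_trivial]

theorem SmoothPeriodic.act_sigmaChoice (hV : SmoothPeriodic b V) (β : ℝ) {w : Conf d → Conf d}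
    (hw : SmoothPeriodic b w) : SmoothPeriodic b fun q => act (sigmaChoice β V q) (w q) := by
  simp only [sigmaChoice, act_smul_left]
  exact (hV.act_hessian hw).const_smul _

theorem act_precision (σ : Conf d → Matrix (Fin d) (Fin d) ℝ) (h : ℝ) (q v : Conf d) :
    act (precision σ h q) v = v + h • act (σ q) v := by
  rw [precision, act_add_left, act_one, act_smul_left]

theorem act_add (M : Matrix (Fin d) (Fin d) ℝ) (v w : Conf d) :
    act M (v + w) = act M v + act M w := by simp [act, Matrix.mulVec_add]

theorem act_sub (M : Matrix (Fin d) (Fin d) ℝ) (v w : Conf d) :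
    act M (v - w) = act M v - act M w := by simp [act, Matrix.mulVec_sub]

theorem act_smul (M : Matrix (Fin d) (Fin d) ℝ) (c : ℝ) (v : Conf d) :
    act M (c • v) = c • act M v := by simp [act, Matrix.mulVec_smul]

theorem act_neg (M : Matrix (Fin d) (Fin d) ℝ) (v : Conf d) :
    act M (-v) = -act M v := by simp [act, Matrix.mulVec_neg]

/-- The terms are grouped by parity in `x`. Exchanging `q` and `q'` reverses `x`, so in the
difference of the two quadratic forms the linear terms add up to endpoint averages and the even ones
become differences. -/
theorem quadForm_precision_add {σ : Conf d → Matrix (Fin d) (Fin d) ℝ} {q : Conf d}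
    (hσ : (σ q).IsHermitian) (h β : ℝ) (x g F : Conf d) :
    quadForm (precision σ h q) (x + h • (β • g - h • F))
      = inner ℝ x x + h * inner ℝ x (act (σ q) x)
        + 2 * h * (β * inner ℝ x g + h * inner ℝ x (β • act (σ q) g - F)
          - h ^ 2 * inner ℝ x (act (σ q) F))
        + h ^ 2 * (β ^ 2 * inner ℝ g g + h * (β ^ 2 * inner ℝ g (act (σ q) g) - 2 * β * inner ℝ g F)
          + h ^ 2 * (inner ℝ F F - 2 * β * inner ℝ g (act (σ q) F))
          + h ^ 3 * inner ℝ F (act (σ q) F)) := by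
  have h1 : inner ℝ g (act (σ q) x) = inner ℝ x (act (σ q) g) := by
    rw [inner_act_of_isHermitian hσ, real_inner_comm]
  have h2 : inner ℝ F (act (σ q) x) = inner ℝ x (act (σ q) F) := by
    rw [inner_act_of_isHermitian hσ, real_inner_comm]
  have h3 : inner ℝ F (act (σ q) g) = inner ℝ g (act (σ q) F) := by
    rw [inner_act_of_isHermitian hσ, real_inner_comm]
  simp only [quadForm_eq_inner, act_precision, act_add, act_sub, act_smul, inner_add_left,
    inner_add_right, inner_sub_left, inner_sub_right, real_inner_smul_left, real_inner_smul_right,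
    h1, h2, h3, real_inner_comm x g, real_inner_comm x F, real_inner_comm g F]
  ring

/-- The potential of which the leading-order correction to the drift is the gradient. -/
noncomputable def correctionPotential (β : ℝ) (V : Conf d → ℝ) (q : Conf d) : ℝ :=
  β ^ 2 / 4 * inner ℝ (gradient V q) (gradient V q) - β / 6 * Laplacian.laplacian V q

theorem SmoothPeriodic.correctionPotential (hV : SmoothPeriodic b V) (β : ℝ) :
    SmoothPeriodic b (correctionPotential β V) :=
  ((hV.gradient.inner hV.gradient).const_mul _).sub (hV.laplacian.const_mul _)

/-- This identity is the reason for the choice of `F`: `β σ ∇V` contributes `β²/3 ∇²V ∇V` and `-F` a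
further `β²/6`, which together make `β²/2 ∇²V ∇V`, the gradient of `β²/4 ‖∇V‖²`. -/
theorem gradient_correctionPotential (hV : SmoothPeriodic b V) (β : ℝ) (q : Conf d) :
    gradient (correctionPotential β V) q
      = β • act (sigmaChoice β V q) (gradient V q) - driftChoice β V q := by
  refine ext_inner_right ℝ fun w => ?_
  have hg : HasFDerivAt (gradient V) (fderiv ℝ (gradient V) q) q :=
    (hV.gradient.smooth.differentiable (by simp) q).hasFDerivAt
  have hL : HasFDerivAt (Laplacian.laplacian V) (fderiv ℝ (Laplacian.laplacian V) q) q :=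
    (hV.laplacian.smooth.differentiable (by simp) q).hasFDerivAt
  have hU : HasFDerivAt (correctionPotential β V) _ q :=
    ((hg.inner ℝ hg).const_mul (β ^ 2 / 4)).sub (hL.const_mul (β / 6))
  have h1 : inner ℝ (act (hessian V q) w) (gradient V q)
      = inner ℝ (act (hessian V q) (gradient V q)) w := by
    rw [← inner_act_of_isHermitian (isHermitian_hessian hV.smooth q), real_inner_comm]
  rw [inner_gradient_left, hU.fderiv]
  simp only [sub_apply, smul_apply, ContinuousLinearMap.comp_apply,
    ContinuousLinearMap.prod_apply, fderivInnerCLM_apply, ← act_hessian hV.smooth,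
    ← inner_gradient_left, sigmaChoice, driftChoice, act_smul_left, inner_sub_left,
    real_inner_smul_left, smul_eq_mul, real_inner_comm (act (hessian V q) w) (gradient V q), h1]
  ring

/-- The logarithm of the Metropolis-Hastings ratio. -/
noncomputable def logRatio (β : ℝ) (V : Conf d → ℝ) (h : ℝ) (q q' : Conf d) : ℝ :=
  β * (V q - V q') + (Real.log (precision (sigmaChoice β V) h q').det
    - Real.log (precision (sigmaChoice β V) h q).det) / 2
  - (quadForm (precision (sigmaChoice β V) h q')
      (q - q' + h • (β • gradient V q' - h • driftChoice β V q'))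
    - quadForm (precision (sigmaChoice β V) h q)
      (q' - q + h • (β • gradient V q - h • driftChoice β V q))) / (4 * h)

theorem acceptMod_eq {β h : ℝ} (hadm : Admissible (sigmaChoice β V) h) (q q' : Conf d) :
    acceptMod β V (sigmaChoice β V) (driftChoice β V) h q q'
      = min (Real.exp (logRatio β V h q q')) 1 := by
  obtain ⟨h0, hpos⟩ := hadm
  have hc : 0 < (1 / (4 * Real.pi * h)) ^ ((d : ℝ) / 2) := by
    have := Real.pi_pos
    positivity
  have hT (x y : Conf d) : transitionMod β V (sigmaChoice β V) (driftChoice β V) h x y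
      = (1 / (4 * Real.pi * h)) ^ ((d : ℝ) / 2)
        * Real.exp (Real.log (precision (sigmaChoice β V) h x).det / 2
          - quadForm (precision (sigmaChoice β V) h x)
            (y - x + h • (β • gradient V x - h • driftChoice β V x)) / (4 * h)) := by
    have hd := (hpos x).det_pos
    rw [transitionMod, sub_eq_add_neg (Real.log _ / 2), Real.exp_add, Real.sqrt_eq_rpow,
      Real.rpow_def_of_pos hd, mul_assoc, mul_one_div]
  rw [acceptMod, hT, hT]
  congr 1
  rw [mul_left_comm, mul_left_comm (Real.exp _), mul_div_mul_left _ _ hc.ne', ← Real.exp_add,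
    ← Real.exp_add, ← Real.exp_sub, logRatio]
  congr 1
  ring

/-- An exact identity, arranged so that each group is a separately estimated error: corrected
trapezoid for `V`, log-determinant minus trace, trapezoid for the correction potential, and
remainders carrying `h²`. -/
theorem logRatio_eq (hV : SmoothPeriodic b V) (β : ℝ) {h : ℝ} (h0 : h ≠ 0) (q q' : Conf d) :
    logRatio β V h q q' =
      -β * (V q' - V q - inner ℝ (q' - q) (gradient V q' + gradient V q) / 2
        + (inner ℝ (q' - q) (act (hessian V q') (q' - q))
          - inner ℝ (q' - q) (act (hessian V q) (q' - q))) / 12)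
      + (Real.log (1 + h • sigmaChoice β V q').det - Real.log (1 + h • sigmaChoice β V q).det
        - h * ((sigmaChoice β V q').trace - (sigmaChoice β V q).trace)) / 2
      - h * (correctionPotential β V q' - correctionPotential β V q
        - inner ℝ (q' - q) (gradient (correctionPotential β V) q'
          + gradient (correctionPotential β V) q) / 2)
      - h ^ 2 * (inner ℝ (q' - q) (act (sigmaChoice β V q') (driftChoice β V q')
          + act (sigmaChoice β V q) (driftChoice β V q)) / 2)
      - h ^ 2 / 4 * (
        ((β ^ 2 * inner ℝ (gradient V q') (act (sigmaChoice β V q') (gradient V q'))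
          - 2 * β * inner ℝ (gradient V q') (driftChoice β V q'))
          - (β ^ 2 * inner ℝ (gradient V q) (act (sigmaChoice β V q) (gradient V q))
          - 2 * β * inner ℝ (gradient V q) (driftChoice β V q)))
        + h * ((inner ℝ (driftChoice β V q') (driftChoice β V q')
            - 2 * β * inner ℝ (gradient V q') (act (sigmaChoice β V q') (driftChoice β V q')))
          - (inner ℝ (driftChoice β V q) (driftChoice β V q)
            - 2 * β * inner ℝ (gradient V q) (act (sigmaChoice β V q) (driftChoice β V q))))
        + h ^ 2 * (inner ℝ (driftChoice β V q') (act (sigmaChoice β V q') (driftChoice β V q'))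
          - inner ℝ (driftChoice β V q) (act (sigmaChoice β V q) (driftChoice β V q)))) := by
  have htr (x : Conf d) : (sigmaChoice β V x).trace = β / 3 * Laplacian.laplacian V x := by
    rw [sigmaChoice, Matrix.trace_smul, trace_hessian, smul_eq_mul]
  have hss (x v : Conf d) : inner ℝ v (act (sigmaChoice β V x) v)
      = β / 3 * inner ℝ v (act (hessian V x) v) := by
    rw [sigmaChoice, act_smul_left, real_inner_smul_right]
  rw [logRatio, quadForm_precision_add (isHermitian_sigmaChoice hV.smooth β q'),
    quadForm_precision_add (isHermitian_sigmaChoice hV.smooth β q),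
    ← gradient_correctionPotential hV, ← gradient_correctionPotential hV, ← neg_sub q' q, act_neg,
    hss q' (gradient V q'), hss q (gradient V q)]
  simp only [inner_neg_left, inner_neg_right, inner_add_right, htr, precision,
    hss q' (q' - q), hss q (q' - q)]
  simp only [correctionPotential]
  field_simp
  ring

theorem abs_logRatio_expansion_le {β h D a B c e p r s K₁ K₂ K₃ K₄ K₅ K₆ K₇ : ℝ} (h0 : 0 < h)
    (h1 : h ≤ 1) (hD : 0 ≤ D) (hK₁ : 0 ≤ K₁) (hK₂ : 0 ≤ K₂) (hK₃ : 0 ≤ K₃) (hK₄ : 0 ≤ K₄)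
    (hK₅ : 0 ≤ K₅) (hK₆ : 0 ≤ K₆) (hK₇ : 0 ≤ K₇)
    (ha : |a| ≤ K₁ * D ^ 5) (hB : |B| ≤ K₂ * h ^ 2 * D) (hc : |c| ≤ K₃ * D ^ 3)
    (he : |e| ≤ K₄ * D) (hp : |p| ≤ K₅ * D) (hr : |r| ≤ K₆ * D) (hs : |s| ≤ K₇ * D) :
    |-β * a + B / 2 - h * c - h ^ 2 * e - h ^ 2 / 4 * (p + h * r + h ^ 2 * s)|
      ≤ (|β| * K₁ + K₂ + K₃ + K₄ + (K₅ + K₆ + K₇)) * (D ^ 5 + h * D ^ 3 + h ^ 2 * D) := by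
  have t1 : |-β * a| ≤ |β| * K₁ * D ^ 5 := by
    rw [abs_mul, abs_neg, mul_assoc]; gcongr
  have t2 : |B / 2| ≤ K₂ * h ^ 2 * D := by
    rw [abs_div, abs_two]; linarith [abs_nonneg B]
  have t3 : |h * c| ≤ h * (K₃ * D ^ 3) := by
    rw [abs_mul, abs_of_pos h0]; gcongr
  have t4 : |h ^ 2 * e| ≤ h ^ 2 * (K₄ * D) := by
    rw [abs_mul, abs_of_pos (by positivity)]; gcongr
  have t5 : |p + h * r + h ^ 2 * s| ≤ (K₅ + K₆ + K₇) * D := by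
    refine (abs_add_three _ _ _).trans ?_
    rw [abs_mul, abs_mul, abs_of_pos h0, abs_of_pos (by positivity : 0 < h ^ 2)]
    have := mul_le_of_le_one_left (abs_nonneg r) h1
    have := mul_le_of_le_one_left (abs_nonneg s) (pow_le_one₀ h0.le h1 : h ^ 2 ≤ 1)
    linarith
  have t6 : |h ^ 2 / 4 * (p + h * r + h ^ 2 * s)| ≤ h ^ 2 * ((K₅ + K₆ + K₇) * D) := by
    rw [abs_mul, abs_of_pos (by positivity : 0 < h ^ 2 / 4)]
    have : h ^ 2 / 4 ≤ h ^ 2 := by linarith [sq_nonneg h]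
    gcongr
  calc _ ≤ |β| * K₁ * D ^ 5 + K₂ * h ^ 2 * D + h * (K₃ * D ^ 3) + h ^ 2 * (K₄ * D)
        + h ^ 2 * ((K₅ + K₆ + K₇) * D) :=
        (abs_sub _ _).trans (add_le_add ((abs_sub _ _).trans (add_le_add ((abs_sub _ _).trans
          (add_le_add ((abs_add_le _ _).trans (add_le_add t1 t2)) t3)) t4)) t6)
    _ = |β| * K₁ * D ^ 5 + K₃ * (h * D ^ 3) + (K₂ + K₄ + (K₅ + K₆ + K₇)) * (h ^ 2 * D) := by ring
    _ ≤ (|β| * K₁ + K₂ + K₃ + K₄ + (K₅ + K₆ + K₇)) * D ^ 5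
        + (|β| * K₁ + K₂ + K₃ + K₄ + (K₅ + K₆ + K₇)) * (h * D ^ 3)
        + (|β| * K₁ + K₂ + K₃ + K₄ + (K₅ + K₆ + K₇)) * (h ^ 2 * D) := by
        have : 0 ≤ |β| * K₁ := by positivity
        gcongr <;> linarith
    _ = _ := by ring

theorem exists_logRatio_le (hV : SmoothPeriodic b V) (β : ℝ) :
    ∃ C h₀, 0 ≤ C ∧ 0 < h₀ ∧ h₀ ≤ 1 ∧ ∀ h : ℝ, 0 < h → h ≤ h₀ → ∀ q q' : Conf d,
      |logRatio β V h q q'|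
        ≤ C * (‖q' - q‖ ^ 5 + h * ‖q' - q‖ ^ 3 + h ^ 2 * ‖q' - q‖) := by
  have hg := hV.gradient
  have hF := hV.driftChoice β
  have hσF := hV.act_sigmaChoice β hF
  obtain ⟨K₁, hK₁, h₁⟩ := exists_corrected_trapezoid_le hV
  obtain ⟨K₂, h₀, hK₂, hh₀, h₂⟩ := exists_log_det_le (b := b) (σ := sigmaChoice β V)
    fun i j => (hV.hessian i j).const_mul (β / 3)
  obtain ⟨K₃, hK₃, h₃⟩ := exists_trapezoid_le (hV.correctionPotential β)
  obtain ⟨K₄, hK₄, h₄⟩ := hσF.bounded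
  obtain ⟨K₅, hK₅, h₅⟩ := (((hg.inner (hV.act_sigmaChoice β hg)).const_mul (β ^ 2)).sub
    ((hg.inner hF).const_mul (2 * β))).lipschitz
  obtain ⟨K₆, hK₆, h₆⟩ := ((hF.inner hF).sub ((hg.inner hσF).const_mul (2 * β))).lipschitz
  obtain ⟨K₇, hK₇, h₇⟩ := (hF.inner hσF).lipschitz
  refine ⟨|β| * K₁ + K₂ + K₃ + K₄ + (K₅ + K₆ + K₇), min h₀ 1, by positivity, by positivity,
    min_le_right _ _, fun h h0 hh q q' => ?_⟩
  have hh1 : h ≤ 1 := hh.trans (min_le_right _ _)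
  specialize h₁ q q'
  specialize h₂ h h0 (hh.trans (min_le_left _ _)) q q'
  specialize h₃ q q'
  specialize h₅ q q'
  specialize h₆ q q'
  specialize h₇ q q'
  -- The explicit factor `q' - q` already supplies the power of `D`, so boundedness suffices here;
  -- the other `h²` remainders need Lipschitz bounds.
  have h₄' : |inner ℝ (q' - q) (act (sigmaChoice β V q') (driftChoice β V q')
      + act (sigmaChoice β V q) (driftChoice β V q)) / 2| ≤ K₄ * ‖q' - q‖ := by
    have := (abs_real_inner_le_norm (q' - q) _).trans
      (mul_le_mul_of_nonneg_left ((norm_add_le _ _).trans (add_le_add (h₄ q') (h₄ q)))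
        (norm_nonneg (q' - q)))
    rw [abs_div, abs_two]
    linarith
  rw [Real.norm_eq_abs] at h₅ h₆ h₇
  rw [logRatio_eq hV β h0.ne']
  exact abs_logRatio_expansion_le h0 hh1 (norm_nonneg _) hK₁ hK₂ hK₃ hK₄ hK₅ hK₆ hK₇
    h₁ h₂ h₃ h₄' h₅ h₆ h₇

end LangevinMH

/-! ### Size of the proposal move, rejection bound and integrability. -/

namespace LangevinMH

variable {d : ℕ} {b : Module.Basis (Fin d) ℝ (Conf d)} {V : Conf d → ℝ}

theorem exists_norm_act_sigmaChoice_le (hV : SmoothPeriodic b V) (β : ℝ) :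
    ∃ K, 0 ≤ K ∧ ∀ q v : Conf d, ‖act (sigmaChoice β V q) v‖ ≤ K * ‖v‖ := by
  obtain ⟨K, hK0, hK⟩ := hV.gradient.fderiv.bounded
  refine ⟨|β / 3| * K, by positivity, fun q v => ?_⟩
  rw [sigmaChoice, act_smul_left, norm_smul, Real.norm_eq_abs, act_hessian hV.smooth, mul_assoc]
  gcongr
  exact (ContinuousLinearMap.le_opNorm _ _).trans (by gcongr; exact hK q)

theorem exists_norm_proposalMod_sub_le (hV : SmoothPeriodic b V) (β : ℝ) :
    ∃ A h₀, 0 ≤ A ∧ 0 < h₀ ∧ ∀ h : ℝ, Admissible (sigmaChoice β V) h → h ≤ h₀ →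
      ∀ q G : Conf d, ‖proposalMod β V (sigmaChoice β V) (driftChoice β V) h q G - q‖
        ≤ A * (Real.sqrt h * (1 + ‖G‖)) := by
  obtain ⟨K, hK0, hK⟩ := exists_norm_act_sigmaChoice_le hV β
  obtain ⟨A₁, hA₁, h₁⟩ := hV.gradient.bounded
  obtain ⟨A₂, hA₂, h₂⟩ := (hV.driftChoice β).bounded
  -- The threshold gives `h * K ≤ 1/2`, hence coercivity of `Id + h σ`. The `8` is `2 + 2 * (2 +
  -- 1)`, from `√(2h) ≤ 2√h` and `‖M^{-1/2} G - G‖ ≤ 3 ‖G‖`.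
  refine ⟨|β| * A₁ + A₂ + 8, min 1 (1 / (2 * (K + 1))), by positivity, by positivity,
    fun h hadm hh q G => ?_⟩
  have h0 := hadm.1
  have hh1 : h ≤ 1 := hh.trans (min_le_left _ _)
  have hhK : h * K ≤ 1 / 2 := by
    have := hh.trans (min_le_right _ _)
    rw [le_div_iff₀ (by positivity)] at this
    nlinarith
  have hlow (v : Conf d) :
      ‖v‖ ^ 2 / 4 ≤ inner ℝ v (act (precision (sigmaChoice β V) h q) v) := by
    rw [act_precision, inner_add_right, real_inner_self_eq_norm_sq, real_inner_smul_right]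
    have h3 : |inner ℝ v (act (sigmaChoice β V q) v)| ≤ ‖v‖ * (K * ‖v‖) :=
      (abs_real_inner_le_norm _ _).trans (by gcongr; exact hK q v)
    have h4 := mul_le_mul_of_nonneg_left (abs_le.1 h3).1 h0.le
    nlinarith [sq_nonneg ‖v‖]
  have hB := norm_act_invSqrt_le (hadm.2 q) hlow G
  set s := Real.sqrt h with hs
  have hs0 : 0 ≤ s := Real.sqrt_nonneg _
  have hsq : h = s ^ 2 := (Real.sq_sqrt h0.le).symm
  have hs1 : s ≤ 1 := Real.sqrt_le_one.2 hh1
  have hhs : h ≤ s := by rw [hsq]; nlinarith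
  have hhs2 : h ^ 2 ≤ s := by nlinarith
  have hs2 : Real.sqrt (2 * h) ≤ 2 * s := by
    rw [Real.sqrt_mul zero_le_two]
    gcongr
    rw [Real.sqrt_le_left zero_le_two]
    norm_num
  have hdecomp : proposalMod β V (sigmaChoice β V) (driftChoice β V) h q G - q
      = -((β * h) • gradient V q) + Real.sqrt (2 * h) • G + h ^ 2 • driftChoice β V q
        + Real.sqrt (2 * h) • (act (invSqrt (precision (sigmaChoice β V) h q)) G - G) := by
    rw [proposalMod, proposalEM, act_sub_left, act_one]
    abel
  rw [hdecomp]
  calc _ ≤ ‖-((β * h) • gradient V q)‖ + ‖Real.sqrt (2 * h) • G‖ + ‖h ^ 2 • driftChoice β V q‖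
        + ‖Real.sqrt (2 * h) • (act (invSqrt (precision (sigmaChoice β V) h q)) G - G)‖ :=
        norm_add₄_le
    _ ≤ |β| * s * A₁ + 2 * s * ‖G‖ + s * A₂ + 2 * s * (2 * ‖G‖ + ‖G‖) := by
        simp only [norm_neg, norm_smul, Real.norm_eq_abs, abs_mul, abs_of_pos h0,
          abs_of_nonneg (Real.sqrt_nonneg (2 * h)), abs_of_nonneg (sq_nonneg h)]
        have := norm_sub_le (act (invSqrt (precision (sigmaChoice β V) h q)) G) G
        gcongr
        · exact h₁ q
        · exact h₂ q
        · exact this.trans (by gcongr)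
    _ = s * (|β| * A₁ + A₂ + 8 * ‖G‖) := by ring
    _ ≤ s * ((|β| * A₁ + A₂ + 8) * (1 + ‖G‖)) := by
        have : 0 ≤ (|β| * A₁ + A₂) * ‖G‖ := by positivity
        gcongr
        nlinarith
    _ = _ := by ring

/-- Only negative `x` matters, and there `exp x ≥ 1 + x`. -/
theorem one_sub_min_exp_mem (x : ℝ) :
    1 - min (Real.exp x) 1 ∈ Set.Icc 0 1 ∧ 1 - min (Real.exp x) 1 ≤ |x| := by
  refine ⟨⟨by linarith [min_le_right (Real.exp x) 1],
    by linarith [le_min (Real.exp_pos x).le zero_le_one]⟩, ?_⟩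
  rcases le_total 0 x with h | h
  · rw [min_eq_right (Real.one_le_exp h), sub_self]
    exact abs_nonneg x
  · rw [min_eq_left (Real.exp_le_one_iff.2 h)]
    linarith [Real.add_one_le_exp x, neg_le_abs x]

theorem exists_one_sub_acceptMod_le (hV : SmoothPeriodic b V) (β : ℝ) :
    ∃ C h₀, 0 ≤ C ∧ 0 < h₀ ∧ ∀ h : ℝ, Admissible (sigmaChoice β V) h → h ≤ h₀ →
      ∀ q G : Conf d, 1 - acceptMod β V (sigmaChoice β V) (driftChoice β V) h q
          (proposalMod β V (sigmaChoice β V) (driftChoice β V) h q G)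
        ≤ C * (Real.sqrt h ^ 5 * (1 + ‖G‖) ^ 5) := by
  obtain ⟨C, h₁, hC, hh₁, hh₁1, hR⟩ := exists_logRatio_le hV β
  obtain ⟨A, h₂, hA, hh₂, hδ⟩ := exists_norm_proposalMod_sub_le hV β
  refine ⟨C * (A ^ 5 + A ^ 3 + A), min h₁ h₂, by positivity, by positivity,
    fun h hadm hh q G => ?_⟩
  rw [acceptMod_eq hadm]
  refine (one_sub_min_exp_mem _).2.trans ((hR h hadm.1 (hh.trans (min_le_left _ _)) q _).trans ?_)
  specialize hδ h hadm (hh.trans (min_le_right _ _)) q G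
  have hsq : h = Real.sqrt h ^ 2 := (Real.sq_sqrt hadm.1.le).symm
  have hs0 : 0 ≤ Real.sqrt h := Real.sqrt_nonneg _
  have hD := norm_nonneg (proposalMod β V (sigmaChoice β V) (driftChoice β V) h q G - q)
  generalize ‖proposalMod β V (sigmaChoice β V) (driftChoice β V) h q G - q‖ = D at *
  generalize Real.sqrt h = s at *
  subst hsq
  have hg : 1 ≤ 1 + ‖G‖ := by linarith [norm_nonneg G]
  generalize 1 + ‖G‖ = g at *
  calc C * (D ^ 5 + s ^ 2 * D ^ 3 + (s ^ 2) ^ 2 * D)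
      ≤ C * ((A * (s * g)) ^ 5 + s ^ 2 * (A * (s * g)) ^ 3 + (s ^ 2) ^ 2 * (A * (s * g))) := by
        gcongr
    _ = C * s ^ 5 * (A ^ 5 * g ^ 5 + A ^ 3 * g ^ 3 + A * g ^ 1) := by ring
    -- With `s = √h`, all three terms carry exactly `s ^ 5`; the powers of `g ≥ 1` are raised to the
    -- largest.
    _ ≤ C * s ^ 5 * (A ^ 5 * g ^ 5 + A ^ 3 * g ^ 5 + A * g ^ 5) := by
        gcongr <;> norm_num
    _ = _ := by ring

theorem integrable_one_add_norm_pow (n : ℕ) :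
    Integrable (fun G : Conf d => (1 + ‖G‖) ^ n) (stdGaussian (Conf d)) := by
  rcases Nat.eq_zero_or_pos n with rfl | hn
  · simp
  have h1 : MemLp (fun G : Conf d => G) n (stdGaussian (Conf d)) :=
    IsGaussian.memLp_id _ _ (ENNReal.natCast_ne_top n)
  have h2 : MemLp (fun G : Conf d => 1 + ‖G‖) n (stdGaussian (Conf d)) :=
    (memLp_const (1 : ℝ)).add h1.norm
  have h3 := h2.integrable_norm_pow hn.ne'
  have h4 (G : Conf d) : ‖1 + ‖G‖‖ = 1 + ‖G‖ := Real.norm_of_nonneg (by positivity)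
  simpa only [h4] using h3

/-- Serves measurability of the integrand; admissibility keeps the determinants away from the
singularity of the logarithm. -/
theorem continuous_logRatio (hV : SmoothPeriodic b V) (β : ℝ) {h : ℝ}
    (hadm : Admissible (sigmaChoice β V) h) (q : Conf d) : Continuous (logRatio β V h q) := by
  have hg := hV.gradient.smooth.continuous
  have hF := (hV.driftChoice β).smooth.continuous
  have hVc := hV.smooth.continuous
  have hH : Continuous fun x => precision (sigmaChoice β V) h x :=
    continuous_matrix fun i j => by
      have := (hV.hessian i j).smooth.continuous
      simp only [precision, sigmaChoice, Matrix.add_apply, Matrix.smul_apply]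
      fun_prop
  have hlog : Continuous fun x => Real.log (precision (sigmaChoice β V) h x).det :=
    hH.matrix_det.log fun x => (hadm.2 x).det_pos.ne'
  have hquad {w : Conf d → Conf d} (M : Conf d → Matrix (Fin d) (Fin d) ℝ) (hM : Continuous M)
      (hw : Continuous w) : Continuous fun x => quadForm (M x) (w x) := by
    have hw' : Continuous fun x => (w x).ofLp := by fun_prop
    exact hw'.dotProduct (hM.matrix_mulVec hw')
  unfold logRatio
  refine (Continuous.add (by fun_prop) ((hlog.sub continuous_const).div_const 2)).sub
    (Continuous.div_const (Continuous.sub (hquad _ hH (by fun_prop))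
      (hquad _ continuous_const (by fun_prop))) _)

theorem continuous_proposalMod (β : ℝ) (V : Conf d → ℝ) (h : ℝ) (q : Conf d) :
    Continuous (proposalMod β V (sigmaChoice β V) (driftChoice β V) h q) := by
  have := continuous_act (invSqrt (precision (sigmaChoice β V) h q) - 1)
  unfold proposalMod proposalEM
  fun_prop

theorem one_sub_acceptMod_mem {β h : ℝ} (hadm : Admissible (sigmaChoice β V) h) (q q' : Conf d) :
    1 - acceptMod β V (sigmaChoice β V) (driftChoice β V) h q q' ∈ Set.Icc 0 1 := by
  rw [acceptMod_eq hadm]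
  exact (one_sub_min_exp_mem _).1

theorem integrable_one_sub_acceptMod_pow (hV : SmoothPeriodic b V) (β : ℝ) {h : ℝ}
    (hadm : Admissible (sigmaChoice β V) h) (q : Conf d) (n : ℕ) :
    Integrable (fun G : Conf d => (1 - acceptMod β V (sigmaChoice β V) (driftChoice β V) h q
      (proposalMod β V (sigmaChoice β V) (driftChoice β V) h q G)) ^ n)
      (stdGaussian (Conf d)) := by
  have hcont : Continuous (fun G : Conf d => (1 - acceptMod β V (sigmaChoice β V)
      (driftChoice β V) h q (proposalMod β V (sigmaChoice β V) (driftChoice β V) h q G)) ^ n) := by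
    simp only [acceptMod_eq hadm]
    have h1 := (continuous_logRatio hV β hadm q).comp (continuous_proposalMod β V h q)
    exact (continuous_const.sub ((Real.continuous_exp.comp h1).min continuous_const)).pow n
  refine Integrable.of_bound hcont.aestronglyMeasurable 1 (.of_forall fun G => ?_)
  have hm := one_sub_acceptMod_mem hadm q
    (proposalMod β V (sigmaChoice β V) (driftChoice β V) h q G)
  rw [Real.norm_eq_abs, abs_of_nonneg (pow_nonneg hm.1 _)]
  exact pow_le_one₀ hm.1 hm.2

end LangevinMH

/-! ### The moment bound. -/

theorem lemma1 (d : ℕ) (β : ℝ) (hβ : 0 < β)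
    (b : Module.Basis (Fin d) ℝ (LangevinMH.Conf d))
    (V : LangevinMH.Conf d → ℝ) (hV : ContDiff ℝ ∞ V) (hper : LangevinMH.IsPeriodic b V)
    (ℓ : ℕ) (hℓ : 1 ≤ ℓ) :
    ∃ C : ℝ, 0 < C ∧
      ∀ Δt : ℝ, LangevinMH.Admissible (LangevinMH.sigmaChoice β V) Δt →
        ∀ q : LangevinMH.Conf d,
          Integrable (fun G : LangevinMH.Conf d =>
            (1 - LangevinMH.acceptMod β V (LangevinMH.sigmaChoice β V)
              (LangevinMH.driftChoice β V) Δt q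
              (LangevinMH.proposalMod β V (LangevinMH.sigmaChoice β V)
                (LangevinMH.driftChoice β V) Δt q G)) ^ (2 * ℓ))
            (stdGaussian (LangevinMH.Conf d)) ∧
          ∫ G : LangevinMH.Conf d,
            (1 - LangevinMH.acceptMod β V (LangevinMH.sigmaChoice β V)
              (LangevinMH.driftChoice β V) Δt q
              (LangevinMH.proposalMod β V (LangevinMH.sigmaChoice β V)
                (LangevinMH.driftChoice β V) Δt q G)) ^ (2 * ℓ)
            ∂(stdGaussian (LangevinMH.Conf d)) ≤ C * Δt ^ (5 * ℓ) := by
  have hSP : LangevinMH.SmoothPeriodic b V := ⟨hV, hper⟩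
  obtain ⟨K, h₀, hK, hh₀, hbound⟩ := LangevinMH.exists_one_sub_acceptMod_le hSP β
  set I := ∫ G : LangevinMH.Conf d, (1 + ‖G‖) ^ (10 * ℓ) ∂(stdGaussian (LangevinMH.Conf d)) with hI
  have hI0 : 0 ≤ I := integral_nonneg fun G => by positivity
  -- The first summand handles `h ≤ h₀`. The second handles `h ≥ h₀`, where `1 ≤ (h / h₀) ^ (5 *
  -- ℓ)`, and also makes the constant strictly positive.
  refine ⟨K ^ (2 * ℓ) * I + (h₀⁻¹) ^ (5 * ℓ), by positivity, fun h hadm q =>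
    ⟨LangevinMH.integrable_one_sub_acceptMod_pow hSP β hadm q _, ?_⟩⟩
  have hint := LangevinMH.integrable_one_sub_acceptMod_pow hSP β hadm q (2 * ℓ)
  have hmem := fun G => LangevinMH.one_sub_acceptMod_mem hadm q
    (LangevinMH.proposalMod β V (LangevinMH.sigmaChoice β V) (LangevinMH.driftChoice β V) h q G)
  have h0 := hadm.1
  rcases le_total h h₀ with hh | hh
  · have hle := integral_mono hint
      ((LangevinMH.integrable_one_add_norm_pow (10 * ℓ)).const_mul (K ^ (2 * ℓ) * h ^ (5 * ℓ)))
      fun G => by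
        refine (pow_le_pow_left₀ (hmem G).1 (hbound h hadm hh q G) (2 * ℓ)).trans_eq ?_
        have hs : h ^ (5 * ℓ) = Real.sqrt h ^ (10 * ℓ) := by
          rw [show 10 * ℓ = 2 * (5 * ℓ) by ring, pow_mul (Real.sqrt h), Real.sq_sqrt h0.le]
        simp only [hs]
        rw [mul_pow, mul_pow, ← pow_mul, ← pow_mul, show 5 * (2 * ℓ) = 10 * ℓ by ring, mul_assoc]
    refine hle.trans ?_
    rw [integral_const_mul, ← hI]
    have : 0 ≤ h₀⁻¹ ^ (5 * ℓ) * h ^ (5 * ℓ) := by positivity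
    nlinarith
  · have hle := integral_mono hint (integrable_const (1 : ℝ))
      fun G => pow_le_one₀ (hmem G).1 (hmem G).2
    rw [integral_const, probReal_univ, one_smul] at hle
    refine hle.trans ?_
    have h1 : 1 ≤ h₀⁻¹ ^ (5 * ℓ) * h ^ (5 * ℓ) := by
      rw [← mul_pow]
      exact one_le_pow₀ (by rwa [← div_eq_inv_mul, one_le_div hh₀])
    have : 0 ≤ K ^ (2 * ℓ) * I * h ^ (5 * ℓ) := by positivity
    linarith [add_mul (K ^ (2 * ℓ) * I) (h₀⁻¹ ^ (5 * ℓ)) (h ^ (5 * ℓ))]
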